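/- Let $\Phi\in\mathbb R^{\eta\times\eta}$, $H\in\mathbb R^{\mu\times\eta}$, let $Q\in\mathbb R^{\eta\times\eta}$ be symmetric positive semidefinite and $R\in\mathbb R^{\mu\times\mu}$ symmetric positive definite, and let $(\Phi,H)$ be detectable, i.e. $\Phi-MH$ has spectral radius less than $1$ for some matrix $M$. For a symmetric positive semidefinite initial covariance $P_{0(-)}$ consider, for $k\ge 0$, the Kalman filter recursion $$K_k=P_{k(-)}H^\top\left(HP_{k(-)}H^\top+R\right)^{-1},\qquad P_{k(+)}=(\mathbb I-K_kH)P_{k(-)},\qquad P_{k+1(-)}=\Phi P_{k(+)}\Phi^\top+Q,$$ and the Rauch--Tung--Striebel smoother gains $L_k=P_{k(+)}\Phi^\top P_{k+1(-)}^{-1}$ (defined for those $k$ for which $P_{k+1(-)}$ is invertible). (i) Suppose in addition that $(\Phi,Q^{1/2})$ is stabilizable, i.e. $\Phi-Q^{1/2}F$ has spectral radius less than $1$ for some matrix $F$. Then there are matrices $P_{\infty(-)},P_{\infty(+)},K_\infty$, not depending on $P_{0(-)}$, with $$P_{\infty(-)}=\Phi P_{\infty(+)}\Phi^\top+Q,\qquad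 K_\infty=P_{\infty(-)}H^\top\left(HP_{\infty(-)}H^\top+R\right)^{-1},\qquad P_{\infty(+)}=(\mathbb I-K_\infty H)P_{\infty(-)},$$ such that for every symmetric positive semidefinite $P_{0(-)}$, as $k\to\infty$, $K_k\to K_\infty$, $P_{k(-)}\to P_{\infty(-)}$ and $P_{k(+)}\to P_{\infty(+)}$; and, if $P_{\infty(+)}$ is invertible, then $L_k$ is defined for all large $k$ and $$L_k\to L_\infty=P_{\infty(+)}\Phi^\top P_{\infty(+)}^{-1}(\mathbb I-K_\infty H).$$ (ii) Without the stabilizability assumption, the convergence of the Kalman gains alone suffices: if for some symmetric positive semidefinite $P_{0(-)}$ the gains $K_k$ converge to a matrix $K_\infty$, then $P_{k(-)}$ and $P_{k(+)}$ converge to matrices $P_{\infty(-)},P_{\infty(+)}$ that satisfy, together with $K_\infty$, the three equations in (i); and, if $P_{\infty(+)}$ is invertible, then $L_k$ is defined for all large $k$ and $L_k\to L_\infty=P_{\infty(+)}\Phi^\top P_{\infty(+)}^{-1}(\mathbb I-K_\infty H)$. -/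

import Mathlib

open Matrix Filter Topology
open scoped MatrixOrder

noncomputable section

namespace KalmanSmoother

variable {n m l : Type*} [Fintype n] [DecidableEq n] [Fintype m] [DecidableEq m] [Fintype l]

/-- A real square matrix is Schur stable if all its complex eigenvalues lie in the open unit
disc. -/
def IsSchurStable (F : Matrix n n ℝ) : Prop :=
  ∀ z ∈ spectrum ℂ (F.map (algebraMap ℝ ℂ)), ‖z‖ < 1

/-- The pair `(Φ, H)` is detectable: some output injection makes `Φ - M H` Schur stable. -/
def IsDetectable (Φ : Matrix n n ℝ) (H : Matrix m n ℝ) : Prop :=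
  ∃ M : Matrix n m ℝ, IsSchurStable (Φ - M * H)

/-- The pair `(Φ, G)` is stabilizable: some state feedback makes `Φ - G F` Schur stable. -/
def IsStabilizable (Φ : Matrix n n ℝ) (G : Matrix n l ℝ) : Prop :=
  ∃ F : Matrix l n ℝ, IsSchurStable (Φ - G * F)

/-- The Kalman gain `P Hᵀ (H P Hᵀ + R)⁻¹` belonging to a prior covariance `P`. -/
def gainOf (H : Matrix m n ℝ) (R : Matrix m m ℝ) (P : Matrix n n ℝ) : Matrix n m ℝ :=
  P * Hᵀ * (H * P * Hᵀ + R)⁻¹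

/-- The posterior covariance `(I - K H) P` belonging to a prior covariance `P`, where `K` is the
Kalman gain of `P`. -/
def posteriorOf (H : Matrix m n ℝ) (R : Matrix m m ℝ) (P : Matrix n n ℝ) : Matrix n n ℝ :=
  (1 - gainOf H R P * H) * P

/-- The prior covariances `P_{k(-)}` of the Kalman filter with `P_{0(-)} = P₀`. -/
def priorCov (Φ : Matrix n n ℝ) (H : Matrix m n ℝ) (Q : Matrix n n ℝ) (R : Matrix m m ℝ)
    (P₀ : Matrix n n ℝ) : ℕ → Matrix n n ℝ
  | 0 => P₀
  | k + 1 => Φ * posteriorOf H R (priorCov Φ H Q R P₀ k) * Φᵀ + Q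

/-- The Kalman gains `K_k`. -/
def kalmanGain (Φ : Matrix n n ℝ) (H : Matrix m n ℝ) (Q : Matrix n n ℝ) (R : Matrix m m ℝ)
    (P₀ : Matrix n n ℝ) (k : ℕ) : Matrix n m ℝ :=
  gainOf H R (priorCov Φ H Q R P₀ k)

/-- The posterior covariances `P_{k(+)}`. -/
def posteriorCov (Φ : Matrix n n ℝ) (H : Matrix m n ℝ) (Q : Matrix n n ℝ) (R : Matrix m m ℝ)
    (P₀ : Matrix n n ℝ) (k : ℕ) : Matrix n n ℝ :=
  posteriorOf H R (priorCov Φ H Q R P₀ k)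

/-- The Rauch-Tung-Striebel smoother gains `L_k = P_{k(+)} Φᵀ P_{k+1(-)}⁻¹`. They are meaningful at
those `k` at which `P_{k+1(-)}` is invertible. -/
def smootherGain (Φ : Matrix n n ℝ) (H : Matrix m n ℝ) (Q : Matrix n n ℝ) (R : Matrix m m ℝ)
    (P₀ : Matrix n n ℝ) (k : ℕ) : Matrix n n ℝ :=
  posteriorCov Φ H Q R P₀ k * Φᵀ * (priorCov Φ H Q R P₀ (k + 1))⁻¹

/-- The steady-state form of the covariance prediction, gain and covariance update equations. -/
def IsSteadyState (Φ : Matrix n n ℝ) (H : Matrix m n ℝ) (Q : Matrix n n ℝ) (R : Matrix m m ℝ)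
    (Pm Pp : Matrix n n ℝ) (K : Matrix n m ℝ) : Prop :=
  Pm = Φ * Pp * Φᵀ + Q ∧ K = Pm * Hᵀ * (H * Pm * Hᵀ + R)⁻¹ ∧ Pp = (1 - K * H) * Pm

end KalmanSmoother

end

/-! Everything reduces to convergence of the priors: gain and posterior are continuous functions of
the prior on positive semidefinite matrices, and `P₊⁻¹ (1 - K H) = P₋⁻¹` gives the limit of the
smoother gains (`tendsto_of_tendsto_priorCov`). Completing the square shows that the Kalman gain
minimizes the predicted covariance over all gains. Hence the Riccati step is monotone, and
comparison with a stable constant-gain observer bounds the priors (`exists_trace_priorCov_le`).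

Stabilizable case: the orbit of zero increases to a fixed point `P`, and an eigenvector argument
makes its closed loop `A` Schur stable. Every orbit lies between that of zero and `P + A ^ k (P₀ -
P) (A ^ k)ᵀ`, so it tends to `P`.

Convergent gains: `A` need not be stable. Every ultrafilter limit of the priors ends a bounded
backward orbit whose gain is constantly `K`. With the gain fixed, the difference of two such orbits
satisfies `D i = A D (i + 1) (Φ - M H)ᵀ` with `Φ - M H` stable, while `A ^ i L i` stays bounded; so
the end points agree (`eq_of_backward_orbits`) and the priors have a single limit. -/

namespace KalmanSmoother

/-! ### Positive semidefinite matrices controlled by their trace -/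

section Trace

variable {n m : Type*} [Fintype n]

lemma posSemidef_mul_mul_transpose [Finite m] {P : Matrix n n ℝ} (hP : P.PosSemidef) (X : Matrix m n ℝ) :
    (X * P * Xᵀ).PosSemidef := by
  simpa [conjTranspose_eq_transpose_of_trivial] using hP.mul_mul_conjTranspose_same X

lemma posSemidef_transpose_eq {n : Type*} {P : Matrix n n ℝ} (hP : P.PosSemidef) : Pᵀ = P := by
  simpa [conjTranspose_eq_transpose_of_trivial] using hP.isHermitian.eq

lemma posSemidef_diag_le_trace {P : Matrix n n ℝ} (hP : P.PosSemidef) (i : n) :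
    P i i ≤ P.trace :=
  Finset.single_le_sum (f := fun i => P i i) (fun _ _ => hP.diag_nonneg) (Finset.mem_univ i)

/-- Cauchy-Schwarz in its arithmetic-mean form. -/
lemma abs_mul_posSemidef_apply_le [DecidableEq n] {P : Matrix n n ℝ} (hP : P.PosSemidef) (X : Matrix n n ℝ)
    (i j : n) : |(X * P) i j| ≤ (X * P * Xᵀ).trace + P.trace := by
  have hsym := posSemidef_transpose_eq hP
  have h1 := posSemidef_mul_mul_transpose hP X
  have d1 := posSemidef_diag_le_trace h1 i
  have d2 := posSemidef_diag_le_trace hP j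
  have d3 : 0 ≤ (X * P * Xᵀ) i i := h1.diag_nonneg
  have d4 : 0 ≤ P j j := hP.diag_nonneg
  -- The quadratic form of `P` at `X i + t e_j`; the values `t = 1` and `t = -1` suffice.
  have key : ∀ t : ℝ, 0 ≤ (X * P * Xᵀ) i i + t * (X * P) i j + t * (X * P) i j + t * t * P j j := by
    intro t
    have h := hP.dotProduct_mulVec_nonneg (X i + t • Pi.single j 1)
    have e1 : (X * P * Xᵀ) i i = X i ⬝ᵥ (P *ᵥ X i) := by
      rw [Matrix.mul_assoc]
      simp only [mul_apply, dotProduct, mulVec, transpose_apply]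
    have e2 : (X * P) i j = X i ⬝ᵥ (P *ᵥ Pi.single j 1) := by
      simp [mul_apply, dotProduct]
    have e3 : (X * P) i j = Pi.single j 1 ⬝ᵥ (P *ᵥ X i) := by
      rw [e2, dotProduct_mulVec, ← mulVec_transpose, hsym, dotProduct_comm]
    have e4 : P j j = Pi.single j 1 ⬝ᵥ (P *ᵥ Pi.single j 1) := by simp
    have : (X * P * Xᵀ) i i + t * (X * P) i j + t * (X * P) i j + t * t * P j j =
        star (X i + t • Pi.single j 1) ⬝ᵥ (P *ᵥ (X i + t • Pi.single j 1)) := by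
      simp only [star_trivial, mulVec_add, mulVec_smul, add_dotProduct, dotProduct_add,
        smul_dotProduct, dotProduct_smul, smul_eq_mul]
      rw [← e1, ← e2, ← e3, ← e4]
      ring
    rw [this]; exact h
  have k1 := key 1
  have k2 := key (-1)
  rw [abs_le]
  constructor <;> linarith

lemma abs_posSemidef_apply_le [DecidableEq n] {P : Matrix n n ℝ} (hP : P.PosSemidef) (i j : n) :
    |P i j| ≤ 2 * P.trace := by
  have := abs_mul_posSemidef_apply_le hP 1 i j
  simp only [Matrix.one_mul, transpose_one, Matrix.mul_one] at this
  linarith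

lemma trace_le_trace {P S : Matrix n n ℝ} (h : P ≤ S) : P.trace ≤ S.trace := by
  have := (Matrix.le_iff.1 h).trace_nonneg
  rw [trace_sub] at this
  linarith

lemma mul_mul_transpose_le [Finite m] {P S : Matrix n n ℝ} (h : P ≤ S) (X : Matrix m n ℝ) :
    X * P * Xᵀ ≤ X * S * Xᵀ := by
  rw [Matrix.le_iff, ← Matrix.sub_mul, ← Matrix.mul_sub]
  exact posSemidef_mul_mul_transpose (Matrix.le_iff.1 h) X

lemma tendsto_matrix_iff {ι l m : Type*} {u : Filter ι} {f : ι → Matrix l m ℝ} {L : Matrix l m ℝ} :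
    Tendsto f u (𝓝 L) ↔ ∀ i j, Tendsto (fun k => f k i j) u (𝓝 (L i j)) := by
  refine tendsto_pi_nhds.trans (forall_congr' fun i => tendsto_pi_nhds)

lemma tendsto_zero_of_trace [DecidableEq n] {ι : Type*} {u : Filter ι} {f : ι → Matrix n n ℝ}
    (hf : ∀ k, (f k).PosSemidef) (ht : Tendsto (fun k => (f k).trace) u (𝓝 0)) :
    Tendsto f u (𝓝 0) := by
  refine tendsto_matrix_iff.2 fun i j => ?_
  refine squeeze_zero_norm (fun k => abs_posSemidef_apply_le (hf k) i j) ?_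
  simpa using ht.const_mul 2

lemma posSemidef_of_tendsto {ι : Type*} {u : Filter ι} [u.NeBot] {f : ι → Matrix n n ℝ}
    {L : Matrix n n ℝ} (hf : ∀ᶠ k in u, (f k).PosSemidef) (h : Tendsto f u (𝓝 L)) :
    L.PosSemidef := by
  refine PosSemidef.of_dotProduct_mulVec_nonneg ?_ fun x => ?_
  · refine tendsto_nhds_unique (f := f) (l := u) ?_ h
    refine Tendsto.congr' ?_
      ((continuous_id.matrix_conjTranspose (R := ℝ) (m := n) (n := n)).continuousAt.tendsto.comp h)
    filter_upwards [hf] with k hk using hk.isHermitian.eq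
  · have hc : Continuous fun M : Matrix n n ℝ => star x ⬝ᵥ (M *ᵥ x) :=
      continuous_const.dotProduct (continuous_id.matrix_mulVec continuous_const)
    refine ge_of_tendsto (hc.continuousAt.tendsto.comp h) ?_
    filter_upwards [hf] with k hk using hk.dotProduct_mulVec_nonneg x

/-- A monotone sequence of positive semidefinite matrices with bounded traces converges. -/
lemma exists_tendsto_of_monotone [DecidableEq n] {f : ℕ → Matrix n n ℝ} (hmono : Monotone f) {c : ℝ}
    (hc : ∀ k, (f k).trace ≤ c) : ∃ L, Tendsto f atTop (𝓝 L) := by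
  -- The traces increase and are bounded, hence Cauchy; each entry of the positive semidefinite
  -- increment `f k - f N` is at most twice its trace.
  have htr : CauchySeq fun k => (f k).trace :=
    (tendsto_atTop_ciSup (fun a b h => trace_le_trace (hmono h))
      ⟨c, by rintro _ ⟨k, rfl⟩; exact hc k⟩).cauchySeq
  have hent : ∀ i j, ∃ x, Tendsto (fun k => f k i j) atTop (𝓝 x) := by
    intro i j
    refine cauchySeq_tendsto_of_complete ?_
    rw [Metric.cauchySeq_iff'] at htr ⊢
    intro ε hε
    obtain ⟨N, hN⟩ := htr (ε / 2) (half_pos hε)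
    refine ⟨N, fun k hk => ?_⟩
    have h1 := abs_posSemidef_apply_le (Matrix.le_iff.1 (hmono hk)) i j
    have h2 := hN k hk
    change |(f k).trace - (f N).trace| < ε / 2 at h2
    change |f k i j - f N i j| < ε
    rw [trace_sub, Matrix.sub_apply] at h1
    have := le_abs_self ((f k).trace - (f N).trace)
    linarith
  choose L hL using hent
  exact ⟨L, tendsto_matrix_iff.2 hL⟩

end Trace

/-! ### Geometric decay of powers of Schur stable matrices -/

section Schur

variable {n : Type*} [Fintype n] [DecidableEq n]

attribute [local instance] Matrix.linftyOpNormedRing Matrix.linftyOpNormedAlgebra in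
-- Gelfand's formula: any `r` strictly between the spectral radius and `1` eventually dominates `‖F
-- ^ k‖ ^ (1 / k)`.
lemma exists_norm_pow_le {F : Matrix n n ℂ} (hF : ∀ z ∈ spectrum ℂ F, ‖z‖ < 1) :
    ∃ C r : ℝ, 0 ≤ C ∧ 0 < r ∧ r < 1 ∧ ∀ k, ‖F ^ k‖ ≤ C * r ^ k := by
  cases isEmpty_or_nonempty n with
  | inl h => exact ⟨0, 1 / 2, le_rfl, by norm_num, by norm_num, fun k => by
      simp [Subsingleton.elim (F ^ k) 0]⟩
  | inr h =>
    have : CompleteSpace (Matrix n n ℂ) := FiniteDimensional.complete ℂ _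
    have hs : spectralRadius ℂ F < ((1 : NNReal) : ENNReal) :=
      spectrum.spectralRadius_lt_of_forall_lt F fun z hz => by
        rw [← NNReal.coe_lt_coe]; simpa using hF z hz
    obtain ⟨r, hr1, hr2⟩ := ENNReal.lt_iff_exists_nnreal_btwn.1 hs
    have hr0 : 0 < r := by
      have : (0 : ENNReal) < r := lt_of_le_of_lt bot_le hr1
      exact_mod_cast this
    have hrlt : r < 1 := by exact_mod_cast hr2
    have hg := (spectrum.pow_nnnorm_pow_one_div_tendsto_nhds_spectralRadius F).eventually
      (gt_mem_nhds hr1)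
    obtain ⟨N, hN⟩ := eventually_atTop.1 (hg.and (eventually_gt_atTop 0))
    have hN' : ∀ k ≥ N, ‖F ^ k‖ ≤ (r : ℝ) ^ k := by
      intro k hk
      obtain ⟨h1, h2⟩ := hN k hk
      have h3 := ENNReal.rpow_le_rpow h1.le (Nat.cast_nonneg k : (0 : ℝ) ≤ k)
      rw [← ENNReal.rpow_mul, one_div, inv_mul_cancel₀ (by positivity), ENNReal.rpow_one,
        ENNReal.rpow_natCast] at h3
      exact_mod_cast h3
    -- The summand `1` serves the exponents from `N` on, the sum the finitely many earlier ones.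
    refine ⟨1 + ∑ k ∈ Finset.range N, ‖F ^ k‖ / (r : ℝ) ^ k, r, by positivity, by exact_mod_cast hr0,
      by exact_mod_cast hrlt, fun k => ?_⟩
    have hrk : (0 : ℝ) < (r : ℝ) ^ k := by positivity
    by_cases hk : N ≤ k
    · refine (hN' k hk).trans (le_mul_of_one_le_left hrk.le ?_)
      have : 0 ≤ ∑ k ∈ Finset.range N, ‖F ^ k‖ / (r : ℝ) ^ k := by positivity
      linarith
    · rw [← div_le_iff₀ hrk]
      have := Finset.single_le_sum (f := fun k => ‖F ^ k‖ / (r : ℝ) ^ k)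
        (fun i _ => by positivity) (Finset.mem_range.2 (not_le.1 hk))
      linarith

attribute [local instance] Matrix.linftyOpNormedRing Matrix.linftyOpNormedAlgebra in
lemma norm_apply_le_linftyOp (F : Matrix n n ℂ) (i j : n) : ‖F i j‖ ≤ ‖F‖ := by
  rw [linfty_opNorm_def]
  have h1 : ‖F i j‖₊ ≤ ∑ j, ‖F i j‖₊ :=
    Finset.single_le_sum (f := fun j => ‖F i j‖₊) (fun _ _ => bot_le) (Finset.mem_univ j)
  have h2 := Finset.le_sup (f := fun i => ∑ j, ‖F i j‖₊) (Finset.mem_univ i)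
  exact_mod_cast h1.trans h2

lemma IsSchurStable.exists_abs_pow_apply_le {F : Matrix n n ℝ} (hF : IsSchurStable F) :
    ∃ C r : ℝ, 0 ≤ C ∧ 0 < r ∧ r < 1 ∧ ∀ k i j, |(F ^ k) i j| ≤ C * r ^ k := by
  obtain ⟨C, r, hC, hr0, hr1, h⟩ := exists_norm_pow_le hF
  refine ⟨C, r, hC, hr0, hr1, fun k i j => ?_⟩
  refine le_trans ?_ ((norm_apply_le_linftyOp _ i j).trans (h k))
  have e : (F.map (algebraMap ℝ ℂ)) ^ k = (F ^ k).map (algebraMap ℝ ℂ) :=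
    (map_pow (algebraMap ℝ ℂ).mapMatrix F k).symm
  rw [e]
  simp

lemma IsSchurStable.tendsto_pow_apply {F : Matrix n n ℝ} (hF : IsSchurStable F) (i j : n) :
    Tendsto (fun k => (F ^ k) i j) atTop (𝓝 0) := by
  obtain ⟨C, r, hC, hr0, hr1, h⟩ := hF.exists_abs_pow_apply_le
  refine squeeze_zero_norm (fun k => h k i j) ?_
  simpa using (tendsto_pow_atTop_nhds_zero_of_lt_one hr0.le hr1).const_mul C

lemma IsSchurStable.tendsto_pow {F : Matrix n n ℝ} (hF : IsSchurStable F) :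
    Tendsto (fun k => F ^ k) atTop (𝓝 0) :=
  tendsto_matrix_iff.2 hF.tendsto_pow_apply

lemma IsSchurStable.exists_trace_le {F : Matrix n n ℝ} (hF : IsSchurStable F) (W : Matrix n n ℝ) :
    ∃ C r : ℝ, 0 ≤ C ∧ 0 < r ∧ r < 1 ∧ ∀ k, (F ^ k * W * (F ^ k)ᵀ).trace ≤ C * r ^ k := by
  obtain ⟨C, r, hC, hr0, hr1, h⟩ := hF.exists_abs_pow_apply_le
  refine ⟨∑ _i : n, ∑ j : n, ∑ l : n, C * |W l j| * C, r, by positivity, hr0, hr1, fun k => ?_⟩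
  -- Both outer factors decay; one rate `r ^ k` is enough, the other is bounded by `1`.
  have hrk : r ^ k ≤ 1 := pow_le_one₀ hr0.le hr1.le
  simp only [trace, diag_apply, mul_apply, transpose_apply, Finset.sum_mul]
  refine Finset.sum_le_sum fun i _ => Finset.sum_le_sum fun j _ => Finset.sum_le_sum fun l _ => ?_
  refine (le_abs_self _).trans ?_
  rw [abs_mul, abs_mul]
  calc |(F ^ k) i l| * |W l j| * |(F ^ k) i j| ≤ (C * r ^ k) * |W l j| * (C * 1) := by
        have h2 : |(F ^ k) i j| ≤ C * 1 :=
          (h k i j).trans (mul_le_mul_of_nonneg_left hrk hC)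
        have h1 := h k i l
        gcongr
    _ = _ := by ring

/-- A left eigenvector of `F` over `ℂ`. -/
lemma mem_spectrum_iff_exists_vecMul_eq_smul {F : Matrix n n ℝ} {z : ℂ} :
    z ∈ spectrum ℂ (F.map (algebraMap ℝ ℂ)) ↔
      ∃ v : n → ℂ, v ≠ 0 ∧ v ᵥ* F.map (algebraMap ℝ ℂ) = z • v := by
  rw [spectrum.mem_iff, Matrix.isUnit_iff_isUnit_det, isUnit_iff_ne_zero, not_not,
    ← Matrix.exists_vecMul_eq_zero_iff]
  refine exists_congr fun v => and_congr_right fun _ => ?_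
  have h : v ᵥ* (algebraMap ℂ (Matrix n n ℂ) z) = z • v := by
    rw [Algebra.algebraMap_eq_smul_one, Matrix.vecMul_smul, Matrix.vecMul_one]
  rw [Matrix.vecMul_sub, h, sub_eq_zero, eq_comm]

end Schur

/-! ### The Riccati step: optimality, monotonicity, boundedness, continuity -/

section Riccati

variable {n m : Type*} [Fintype n] [Fintype m] [DecidableEq n] [DecidableEq m]
  {Φ : Matrix n n ℝ} {H : Matrix m n ℝ} {Q : Matrix n n ℝ} {R : Matrix m m ℝ}

/-- One step of the recursion for the prior covariances. -/
noncomputable def riccatiStep (Φ : Matrix n n ℝ) (H : Matrix m n ℝ) (Q : Matrix n n ℝ) (R : Matrix m m ℝ)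
    (P : Matrix n n ℝ) : Matrix n n ℝ :=
  Φ * posteriorOf H R P * Φᵀ + Q

lemma priorCov_succ (P₀ : Matrix n n ℝ) (k : ℕ) :
    priorCov Φ H Q R P₀ (k + 1) = riccatiStep Φ H Q R (priorCov Φ H Q R P₀ k) := rfl

omit [DecidableEq n] [DecidableEq m] in
lemma posDef_innovation (hR : R.PosDef) {P : Matrix n n ℝ} (hP : P.PosSemidef) :
    (H * P * Hᵀ + R).PosDef :=
  PosDef.posSemidef_add (posSemidef_mul_mul_transpose hP H) hR

omit [DecidableEq n] in
lemma gainOf_mul_innovation (hR : R.PosDef) {P : Matrix n n ℝ} (hP : P.PosSemidef) :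
    gainOf H R P * (H * P * Hᵀ + R) = P * Hᵀ := by
  have h := (Matrix.isUnit_iff_isUnit_det _).1 (posDef_innovation (H := H) hR hP).isUnit
  rw [gainOf, Matrix.mul_assoc, Matrix.nonsing_inv_mul _ h, Matrix.mul_one]

omit [DecidableEq n] in
lemma innovation_mul_gainOf_transpose (hR : R.PosDef) {P : Matrix n n ℝ} (hP : P.PosSemidef) :
    (H * P * Hᵀ + R) * (gainOf H R P)ᵀ = H * P := by
  have h := congrArg transpose (gainOf_mul_innovation (H := H) hR hP)
  rwa [transpose_mul, posSemidef_transpose_eq (posDef_innovation hR hP).posSemidef, transpose_mul,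
    transpose_transpose, posSemidef_transpose_eq hP] at h

/-- Completing the square in the predictor gain. -/
lemma predictor_eq_riccatiStep_add (hR : R.PosDef) {P : Matrix n n ℝ} (hP : P.PosSemidef)
    (M : Matrix n m ℝ) :
    (Φ - M * H) * P * (Φ - M * H)ᵀ + (M * R * Mᵀ + Q) = riccatiStep Φ H Q R P +
      (M - Φ * gainOf H R P) * (H * P * Hᵀ + R) * (M - Φ * gainOf H R P)ᵀ := by
  have h1 := gainOf_mul_innovation (H := H) hR hP
  have h2 := innovation_mul_gainOf_transpose (H := H) hR hP
  set K := gainOf H R P with hK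
  have e : (M - Φ * K) * (H * P * Hᵀ + R) * (M - Φ * K)ᵀ =
      M * (H * P * Hᵀ + R) * Mᵀ - M * ((H * P * Hᵀ + R) * Kᵀ) * Φᵀ
        - Φ * (K * (H * P * Hᵀ + R)) * Mᵀ + Φ * K * ((H * P * Hᵀ + R) * Kᵀ) * Φᵀ := by
    rw [transpose_sub, transpose_mul]
    simp only [Matrix.sub_mul, Matrix.mul_sub, Matrix.mul_assoc]
    abel
  rw [e, h1, h2, riccatiStep, posteriorOf, ← hK, transpose_sub, transpose_mul]
  simp only [Matrix.sub_mul, Matrix.mul_sub, Matrix.mul_add, Matrix.add_mul, Matrix.mul_assoc,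
    Matrix.one_mul]
  abel

/-- The Joseph form: the square vanishes at `M = Φ K`. Unlike the definition, it is visibly positive
semidefinite. -/
lemma riccatiStep_eq_predictor (hR : R.PosDef) {P : Matrix n n ℝ} (hP : P.PosSemidef) :
    riccatiStep Φ H Q R P = (Φ - Φ * gainOf H R P * H) * P * (Φ - Φ * gainOf H R P * H)ᵀ +
      (Φ * gainOf H R P * R * (Φ * gainOf H R P)ᵀ + Q) := by
  rw [predictor_eq_riccatiStep_add hR hP]
  simp

lemma riccatiStep_le_predictor (hR : R.PosDef) {P : Matrix n n ℝ} (hP : P.PosSemidef)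
    (M : Matrix n m ℝ) :
    riccatiStep Φ H Q R P ≤ (Φ - M * H) * P * (Φ - M * H)ᵀ + (M * R * Mᵀ + Q) := by
  rw [predictor_eq_riccatiStep_add hR hP, Matrix.le_iff, add_sub_cancel_left]
  exact posSemidef_mul_mul_transpose (posDef_innovation hR hP).posSemidef _

lemma posSemidef_riccatiStep (hQ : Q.PosSemidef) (hR : R.PosDef) {P : Matrix n n ℝ}
    (hP : P.PosSemidef) : (riccatiStep Φ H Q R P).PosSemidef := by
  rw [riccatiStep_eq_predictor hR hP]
  exact (posSemidef_mul_mul_transpose hP _).add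
    ((posSemidef_mul_mul_transpose hR.posSemidef _).add hQ)

/-- Freeze the gain of `S`: it is suboptimal for `P` and optimal for `S`, and a step with frozen
gain is monotone. -/
lemma riccatiStep_mono (hR : R.PosDef) {P S : Matrix n n ℝ} (hP : P.PosSemidef)
    (hS : S.PosSemidef) (h : P ≤ S) : riccatiStep Φ H Q R P ≤ riccatiStep Φ H Q R S := by
  refine (riccatiStep_le_predictor hR hP (Φ * gainOf H R S)).trans ?_
  rw [riccatiStep_eq_predictor hR hS]
  exact add_le_add_left (mul_mul_transpose_le h _) _

lemma posSemidef_priorCov (hQ : Q.PosSemidef) (hR : R.PosDef) {P₀ : Matrix n n ℝ}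
    (h₀ : P₀.PosSemidef) (k : ℕ) : (priorCov Φ H Q R P₀ k).PosSemidef := by
  induction k with
  | zero => exact h₀
  | succ k ih => exact posSemidef_riccatiStep hQ hR ih

lemma priorCov_mono (hQ : Q.PosSemidef) (hR : R.PosDef) {P₀ S₀ : Matrix n n ℝ}
    (hP : P₀.PosSemidef) (hS : S₀.PosSemidef) (h : P₀ ≤ S₀) (k : ℕ) :
    priorCov Φ H Q R P₀ k ≤ priorCov Φ H Q R S₀ k := by
  induction k with
  | zero => exact h
  | succ k ih =>
    exact riccatiStep_mono hR (posSemidef_priorCov hQ hR hP k) (posSemidef_priorCov hQ hR hS k) ih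

lemma priorCov_add (P₀ : Matrix n n ℝ) (j k : ℕ) :
    priorCov Φ H Q R P₀ (j + k) = priorCov Φ H Q R (priorCov Φ H Q R P₀ j) k := by
  induction k with
  | zero => rfl
  | succ k ih => rw [← add_assoc, priorCov_succ, ih, priorCov_succ]

/-- The covariances started at zero increase. -/
lemma monotone_priorCov_zero (hQ : Q.PosSemidef) (hR : R.PosDef) :
    Monotone (priorCov Φ H Q R 0) := by
  refine monotone_nat_of_le_succ fun k => ?_
  -- The orbit of zero shifted by one is the orbit of `P₁ ≥ 0`.
  rw [add_comm, priorCov_add]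
  have h1 := posSemidef_priorCov (Φ := Φ) (H := H) hQ hR PosSemidef.zero 1
  exact priorCov_mono hQ hR PosSemidef.zero h1 (Matrix.nonneg_iff_posSemidef.2 h1) k

/-- Comparison with the filter that uses a constant predictor gain. -/
lemma priorCov_le_sum (hQ : Q.PosSemidef) (hR : R.PosDef) {P₀ : Matrix n n ℝ}
    (h₀ : P₀.PosSemidef) (M : Matrix n m ℝ) (k : ℕ) :
    priorCov Φ H Q R P₀ k ≤ (Φ - M * H) ^ k * P₀ * ((Φ - M * H) ^ k)ᵀ +
      ∑ i ∈ Finset.range k, (Φ - M * H) ^ i * (M * R * Mᵀ + Q) * ((Φ - M * H) ^ i)ᵀ := by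
  induction k with
  | zero => simp [priorCov]
  | succ k ih =>
    rw [priorCov_succ]
    refine (riccatiStep_le_predictor hR (posSemidef_priorCov hQ hR h₀ k) M).trans ?_
    refine (add_le_add_left (mul_mul_transpose_le ih _) _).trans (le_of_eq ?_)
    rw [Finset.sum_range_succ', Matrix.mul_add, Matrix.add_mul, Finset.mul_sum, Finset.sum_mul]
    simp only [pow_zero, Matrix.one_mul, transpose_one, Matrix.mul_one, pow_succ', transpose_mul,
      Matrix.mul_assoc, add_assoc]

/-- Under detectability the prior covariances stay bounded. -/
lemma exists_trace_priorCov_le (hQ : Q.PosSemidef) (hR : R.PosDef) (hdet : IsDetectable Φ H)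
    {P₀ : Matrix n n ℝ} (h₀ : P₀.PosSemidef) :
    ∃ c : ℝ, ∀ k, (priorCov Φ H Q R P₀ k).trace ≤ c := by
  obtain ⟨M, hM⟩ := hdet
  obtain ⟨C, r, hC, hr0, hr1, h1⟩ := hM.exists_trace_le P₀
  obtain ⟨C', r', hC', hr0', hr1', h2⟩ := hM.exists_trace_le (M * R * Mᵀ + Q)
  refine ⟨C + C' * (1 - r')⁻¹, fun k => ?_⟩
  refine (trace_le_trace (priorCov_le_sum hQ hR h₀ M k)).trans ?_
  rw [trace_add, trace_sum]
  refine add_le_add ((h1 k).trans (mul_le_of_le_one_right hC (pow_le_one₀ hr0.le hr1.le))) ?_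
  refine (Finset.sum_le_sum fun i _ => h2 i).trans ?_
  rw [← Finset.mul_sum]
  refine mul_le_mul_of_nonneg_left ?_ hC'
  rw [← tsum_geometric_of_lt_one hr0'.le hr1']
  exact (summable_geometric_of_lt_one hr0'.le hr1').sum_le_tsum _ fun i _ => by positivity

lemma continuousAt_inv_of_isUnit {l : Type*} [Fintype l] [DecidableEq l] {A : Matrix l l ℝ}
    (hA : IsUnit A) : ContinuousAt (fun B : Matrix l l ℝ => B⁻¹) A := by
  have hA' : A.det ≠ 0 := ((Matrix.isUnit_iff_isUnit_det _).1 hA).ne_zero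
  refine continuousAt_matrix_inv A ?_
  rw [Ring.inverse_eq_inv']
  exact continuousAt_inv₀ hA'

lemma tendsto_matrix_mul {ι l m p : Type*} [Fintype m] {u : Filter ι} {f : ι → Matrix l m ℝ}
    {g : ι → Matrix m p ℝ} {A : Matrix l m ℝ} {B : Matrix m p ℝ} (hf : Tendsto f u (𝓝 A))
    (hg : Tendsto g u (𝓝 B)) : Tendsto (fun k => f k * g k) u (𝓝 (A * B)) := by
  have hc : Continuous fun x : Matrix l m ℝ × Matrix m p ℝ => x.1 * x.2 :=
    continuous_fst.matrix_mul continuous_snd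
  exact (hc.tendsto (A, B)).comp (hf.prodMk_nhds hg)

omit [DecidableEq n] in
lemma continuousAt_gainOf (hR : R.PosDef) {P : Matrix n n ℝ} (hP : P.PosSemidef) :
    ContinuousAt (gainOf H R) P := by
  have hc : Continuous fun P : Matrix n n ℝ => H * P * Hᵀ + R :=
    ((continuous_const.matrix_mul continuous_id).matrix_mul continuous_const).add continuous_const
  exact tendsto_matrix_mul (tendsto_matrix_mul tendsto_id tendsto_const_nhds)
    ((continuousAt_inv_of_isUnit (posDef_innovation hR hP).isUnit).tendsto.comp (hc.tendsto P))

lemma continuousAt_posteriorOf (hR : R.PosDef) {P : Matrix n n ℝ} (hP : P.PosSemidef) :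
    ContinuousAt (posteriorOf H R) P :=
  tendsto_matrix_mul (tendsto_const_nhds.sub
    (tendsto_matrix_mul (continuousAt_gainOf hR hP).tendsto tendsto_const_nhds)) tendsto_id

lemma continuousAt_riccatiStep (hR : R.PosDef) {P : Matrix n n ℝ} (hP : P.PosSemidef) :
    ContinuousAt (riccatiStep Φ H Q R) P := by
  have hc : Continuous fun X : Matrix n n ℝ => Φ * X * Φᵀ + Q :=
    ((continuous_const.matrix_mul continuous_id).matrix_mul continuous_const).add continuous_const
  exact hc.continuousAt.comp (continuousAt_posteriorOf hR hP)

lemma riccatiStep_eq_self_of_tendsto (hQ : Q.PosSemidef) (hR : R.PosDef) {P₀ Pm : Matrix n n ℝ}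
    (h₀ : P₀.PosSemidef) (h : Tendsto (priorCov Φ H Q R P₀) atTop (𝓝 Pm)) :
    riccatiStep Φ H Q R Pm = Pm := by
  have hPm := posSemidef_of_tendsto (Eventually.of_forall (posSemidef_priorCov hQ hR h₀)) h
  exact tendsto_nhds_unique ((continuousAt_riccatiStep hR hPm).tendsto.comp h)
    (h.comp (tendsto_add_atTop_nat 1))

lemma isSteadyState_of_riccatiStep_eq_self {Pm : Matrix n n ℝ} (h : riccatiStep Φ H Q R Pm = Pm) :
    IsSteadyState Φ H Q R Pm (posteriorOf H R Pm) (gainOf H R Pm) :=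
  ⟨h.symm, rfl, rfl⟩

/-- Convergence of the prior covariances entails that of the gains, of the posterior covariances
and, if the limit posterior covariance is invertible, of the smoother gains. -/
lemma tendsto_of_tendsto_priorCov (hQ : Q.PosSemidef) (hR : R.PosDef) {P₀ Pm : Matrix n n ℝ}
    (h₀ : P₀.PosSemidef) (h : Tendsto (priorCov Φ H Q R P₀) atTop (𝓝 Pm)) :
    Tendsto (kalmanGain Φ H Q R P₀) atTop (𝓝 (gainOf H R Pm)) ∧
    Tendsto (posteriorCov Φ H Q R P₀) atTop (𝓝 (posteriorOf H R Pm)) ∧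
    (IsUnit (posteriorOf H R Pm) →
      (∀ᶠ k in atTop, IsUnit (priorCov Φ H Q R P₀ (k + 1))) ∧
      Tendsto (smootherGain Φ H Q R P₀) atTop
        (𝓝 (posteriorOf H R Pm * Φᵀ * (posteriorOf H R Pm)⁻¹ * (1 - gainOf H R Pm * H)))) := by
  have hPm := posSemidef_of_tendsto (Eventually.of_forall (posSemidef_priorCov hQ hR h₀)) h
  have hpost : Tendsto (posteriorCov Φ H Q R P₀) atTop (𝓝 (posteriorOf H R Pm)) :=
    (continuousAt_posteriorOf hR hPm).tendsto.comp h
  refine ⟨(continuousAt_gainOf hR hPm).tendsto.comp h, hpost, fun hu => ?_⟩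
  -- Invertibility of the posterior passes to both of its factors, `1 - K H` and `Pm`.
  have hdet : (posteriorOf H R Pm).det = (1 - gainOf H R Pm * H).det * Pm.det := by
    rw [posteriorOf, det_mul]
  have hpu := ((Matrix.isUnit_iff_isUnit_det _).1 hu).ne_zero
  rw [hdet] at hpu
  have hA : IsUnit (1 - gainOf H R Pm * H).det := (left_ne_zero_of_mul hpu).isUnit
  have hdetPm : Pm.det ≠ 0 := right_ne_zero_of_mul hpu
  have hPmu : IsUnit Pm := (Matrix.isUnit_iff_isUnit_det _).2 hdetPm.isUnit
  have h' := h.comp (tendsto_add_atTop_nat 1)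
  constructor
  · have := ((continuous_id.matrix_det.continuousAt (x := Pm)).tendsto.comp h').eventually_ne
      (b₂ := 0) hdetPm
    filter_upwards [this] with k hk
    exact (Matrix.isUnit_iff_isUnit_det _).2 (isUnit_iff_ne_zero.2 hk)
  · have hinv : (posteriorOf H R Pm)⁻¹ * (1 - gainOf H R Pm * H) = Pm⁻¹ := by
      rw [posteriorOf, Matrix.mul_inv_rev, Matrix.mul_assoc, Matrix.nonsing_inv_mul _ hA,
        Matrix.mul_one]
    rw [Matrix.mul_assoc _ _ (1 - _), hinv]
    exact tendsto_matrix_mul (tendsto_matrix_mul hpost tendsto_const_nhds)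
      ((continuousAt_inv_of_isUnit hPmu).tendsto.comp h')

end Riccati

/-! ### Stabilizable case: stability of the fixed point and squeezing -/

section Stabilizable

variable {n m l : Type*} [Fintype n] [Fintype m] [Fintype l]

/-- The squared Euclidean norm of the row vector `v X`, for a real matrix `X`. -/
noncomputable def rowSq (v : n → ℂ) (X : Matrix n l ℝ) : ℝ :=
  ∑ i, ‖(v ᵥ* X.map (algebraMap ℝ ℂ)) i‖ ^ 2

lemma rowSq_nonneg (v : n → ℂ) (X : Matrix n l ℝ) : 0 ≤ rowSq v X := by
  unfold rowSq; positivity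

lemma rowSq_eq_zero_iff {v : n → ℂ} {X : Matrix n l ℝ} :
    rowSq v X = 0 ↔ v ᵥ* X.map (algebraMap ℝ ℂ) = 0 := by
  rw [rowSq, Finset.sum_eq_zero_iff_of_nonneg fun i _ => by positivity]
  simp [funext_iff]

/-- Turns the quadratic form of `X Xᵀ` at a complex vector into a real nonnegative number, so that
the fixed-point equation can be tested on a complex eigenvector. -/
lemma ofReal_rowSq (v : n → ℂ) (X : Matrix n l ℝ) :
    (rowSq v X : ℂ) = v ᵥ* (X * Xᵀ).map (algebraMap ℝ ℂ) ⬝ᵥ star v := by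
  have hs : (Xᵀ.map (algebraMap ℝ ℂ)) = (X.map (algebraMap ℝ ℂ))ᴴ := by
    ext i j; simp
  rw [Matrix.map_mul, hs, ← vecMul_vecMul, ← dotProduct_mulVec, ← star_vecMul]
  simp [rowSq, dotProduct, Complex.mul_conj, Complex.normSq_eq_norm_sq]

lemma rowSq_mul_of_vecMul_eq_smul {A : Matrix n n ℝ} {v : n → ℂ} {z : ℂ}
    (h : v ᵥ* A.map (algebraMap ℝ ℂ) = z • v) (X : Matrix n l ℝ) :
    rowSq v (A * X) = ‖z‖ ^ 2 * rowSq v X := by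
  simp only [rowSq, Matrix.map_mul, ← vecMul_vecMul, h, smul_vecMul, Pi.smul_apply, smul_eq_mul,
    norm_mul, mul_pow, Finset.mul_sum]

lemma exists_symm_sq [DecidableEq n] {P : Matrix n n ℝ} (hP : P.PosSemidef) :
    CFC.sqrt P * (CFC.sqrt P)ᵀ = P := by
  have h0 : (0 : Matrix n n ℝ) ≤ P := Matrix.nonneg_iff_posSemidef.2 hP
  rw [posSemidef_transpose_eq (Matrix.nonneg_iff_posSemidef.1 (CFC.sqrt_nonneg P)),
    CFC.sqrt_mul_sqrt_self P h0]

variable [DecidableEq n] [DecidableEq m]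
  {Φ : Matrix n n ℝ} {H : Matrix m n ℝ} {Q : Matrix n n ℝ} {R : Matrix m m ℝ}

/-- A positive semidefinite fixed point of the Riccati recursion is stabilizing. -/
lemma isSchurStable_of_riccatiStep_eq_self (hQ : Q.PosSemidef) (hR : R.PosDef)
    (hstab : IsStabilizable Φ (CFC.sqrt Q)) {P : Matrix n n ℝ} (hP : P.PosSemidef)
    (hfix : riccatiStep Φ H Q R P = P) : IsSchurStable (Φ - Φ * gainOf H R P * H) := by
  obtain ⟨F, hF⟩ := hstab
  intro z hz
  obtain ⟨v, hv0, hv⟩ := mem_spectrum_iff_exists_vecMul_eq_smul.1 hz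
  by_contra hz1
  rw [not_lt] at hz1
  set A := Φ - Φ * gainOf H R P * H with hA
  set B := Φ * gainOf H R P with hB
  have hQ' := exists_symm_sq hQ
  have hR' := exists_symm_sq hR.posSemidef
  have hP' := exists_symm_sq hP
  have heq : CFC.sqrt P * (CFC.sqrt P)ᵀ = (A * CFC.sqrt P) * (A * CFC.sqrt P)ᵀ +
      ((B * CFC.sqrt R) * (B * CFC.sqrt R)ᵀ + CFC.sqrt Q * (CFC.sqrt Q)ᵀ) := by
    have h := riccatiStep_eq_predictor (Φ := Φ) (H := H) (Q := Q) hR hP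
    rw [hfix, ← hB, ← hA] at h
    have e1 : (A * CFC.sqrt P) * (A * CFC.sqrt P)ᵀ = A * P * Aᵀ := by
      conv_rhs => rw [← hP']
      simp only [transpose_mul, Matrix.mul_assoc]
    have e2 : (B * CFC.sqrt R) * (B * CFC.sqrt R)ᵀ = B * R * Bᵀ := by
      conv_rhs => rw [← hR']
      simp only [transpose_mul, Matrix.mul_assoc]
    rw [e1, e2, hQ', hP']
    exact h
  -- The fixed-point equation evaluated at `v`. As `v A = z v` with `‖z‖ ≥ 1`, the noise terms in
  -- `R` and `Q` must both vanish.
  have hsum : rowSq v (CFC.sqrt P) = rowSq v (A * CFC.sqrt P) +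
      (rowSq v (B * CFC.sqrt R) + rowSq v (CFC.sqrt Q)) := by
    have : (rowSq v (CFC.sqrt P) : ℂ) = rowSq v (A * CFC.sqrt P) +
        (rowSq v (B * CFC.sqrt R) + rowSq v (CFC.sqrt Q)) := by
      simp only [ofReal_rowSq]
      rw [heq, Matrix.map_add _ (map_add _), Matrix.map_add _ (map_add _)]
      simp only [vecMul_add, add_dotProduct]
    exact_mod_cast this
  rw [rowSq_mul_of_vecMul_eq_smul hv] at hsum
  have p1 := rowSq_nonneg v (CFC.sqrt P)
  have p2 := rowSq_nonneg v (B * CFC.sqrt R)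
  have p3 := rowSq_nonneg v (CFC.sqrt Q)
  have p4 : rowSq v (CFC.sqrt P) ≤ ‖z‖ ^ 2 * rowSq v (CFC.sqrt P) :=
    le_mul_of_one_le_left p1 (one_le_pow₀ hz1)
  have q2 := rowSq_eq_zero_iff.1 (show rowSq v (B * CFC.sqrt R) = 0 by linarith)
  have q3 := rowSq_eq_zero_iff.1 (show rowSq v (CFC.sqrt Q) = 0 by linarith)
  have hvB : v ᵥ* B.map (algebraMap ℝ ℂ) = 0 := by
    have hu : IsUnit R.det := (Matrix.isUnit_iff_isUnit_det _).1 hR.isUnit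
    have hinv : B = (B * CFC.sqrt R) * ((CFC.sqrt R)ᵀ * R⁻¹) := by
      rw [Matrix.mul_assoc, ← Matrix.mul_assoc (CFC.sqrt R), hR', Matrix.mul_nonsing_inv _ hu,
        Matrix.mul_one]
    rw [hinv, Matrix.map_mul, ← vecMul_vecMul, q2, zero_vecMul]
  -- Since `v` annihilates both `B` and `CFC.sqrt Q`, feedback cannot move the eigenvalue `z`,
  -- against stabilizability.
  have hΦ : v ᵥ* (Φ - CFC.sqrt Q * F).map (algebraMap ℝ ℂ) = z • v := by
    have e : Φ - CFC.sqrt Q * F = A + B * H - CFC.sqrt Q * F := by rw [hA, sub_add_cancel]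
    rw [e, Matrix.map_sub _ (map_sub _), Matrix.map_add _ (map_add _),
      Matrix.map_mul (L := B) (M := H), Matrix.map_mul (L := CFC.sqrt Q), vecMul_sub, vecMul_add,
      ← vecMul_vecMul, ← vecMul_vecMul, hvB, q3, hv]
    simp
  exact absurd (hF z (mem_spectrum_iff_exists_vecMul_eq_smul.2 ⟨v, hv0, hΦ⟩)) (not_lt.2 hz1)

/-- Upper bound for the deviation from a fixed point. -/
lemma priorCov_sub_le (hQ : Q.PosSemidef) (hR : R.PosDef) {P P₀ : Matrix n n ℝ}
    (hP : P.PosSemidef) (h₀ : P₀.PosSemidef) (hfix : riccatiStep Φ H Q R P = P) (k : ℕ) :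
    priorCov Φ H Q R P₀ k ≤ P + (Φ - Φ * gainOf H R P * H) ^ k * (P₀ - P) *
      ((Φ - Φ * gainOf H R P * H) ^ k)ᵀ := by
  induction k with
  | zero => simp [priorCov]
  | succ k ih =>
    rw [priorCov_succ]
    have h := riccatiStep_eq_predictor (Φ := Φ) (H := H) (Q := Q) hR hP
    rw [hfix] at h
    refine (riccatiStep_le_predictor hR (posSemidef_priorCov hQ hR h₀ k)
      (Φ * gainOf H R P)).trans ?_
    set A := Φ - Φ * gainOf H R P * H
    refine (add_le_add_left (mul_mul_transpose_le ih A) _).trans (le_of_eq ?_)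
    rw [Matrix.mul_add, Matrix.add_mul, add_right_comm, ← h]
    simp only [pow_succ', transpose_mul, Matrix.mul_assoc]

/-- The squeeze theorem in the Loewner order: `0 ≤ p - f ≤ g - f`, and the trace of `p - f` controls
its entries. -/
lemma tendsto_of_le_of_le {Pm : Matrix n n ℝ} {f g : ℕ → Matrix n n ℝ}
    (hf : Tendsto f atTop (𝓝 Pm)) (hg : Tendsto g atTop (𝓝 Pm)) {p : ℕ → Matrix n n ℝ}
    (h1 : ∀ k, f k ≤ p k) (h2 : ∀ k, p k ≤ g k) : Tendsto p atTop (𝓝 Pm) := by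
  have hc : Continuous fun X : Matrix n n ℝ => X.trace := continuous_id.matrix_trace
  have h3 : Tendsto (fun k => p k - f k) atTop (𝓝 0) := by
    refine tendsto_zero_of_trace (fun k => Matrix.le_iff.1 (h1 k)) ?_
    have hz : Tendsto (fun k => (g k - f k).trace) atTop (𝓝 0) := by
      have := (hc.tendsto _).comp (hg.sub hf)
      simpa [Function.comp_def] using this
    refine squeeze_zero (fun k => (Matrix.le_iff.1 (h1 k)).trace_nonneg)
      (fun k => trace_le_trace (sub_le_sub_right (h2 k) _)) hz
  simpa using h3.add hf

/-- In the detectable and stabilizable case the covariances converge to the same limit for all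
initial values. -/
lemma exists_tendsto_priorCov (hQ : Q.PosSemidef) (hR : R.PosDef) (hdet : IsDetectable Φ H)
    (hstab : IsStabilizable Φ (CFC.sqrt Q)) :
    ∃ Pm : Matrix n n ℝ, ∀ P₀ : Matrix n n ℝ, P₀.PosSemidef →
      Tendsto (priorCov Φ H Q R P₀) atTop (𝓝 Pm) := by
  obtain ⟨c, hc⟩ := exists_trace_priorCov_le hQ hR hdet (PosSemidef.zero (R := ℝ) (n := n))
  obtain ⟨Pm, hlim⟩ := exists_tendsto_of_monotone (monotone_priorCov_zero hQ hR) hc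
  have hPm : Pm.PosSemidef :=
    posSemidef_of_tendsto (Eventually.of_forall (posSemidef_priorCov hQ hR .zero)) hlim
  have hfix := riccatiStep_eq_self_of_tendsto hQ hR .zero hlim
  have hS := isSchurStable_of_riccatiStep_eq_self hQ hR hstab hPm hfix
  have hA := hS.tendsto_pow
  refine ⟨Pm, fun P₀ h₀ => tendsto_of_le_of_le hlim ?_
    (priorCov_mono hQ hR .zero h₀ (Matrix.nonneg_iff_posSemidef.2 h₀))
    (priorCov_sub_le hQ hR hPm h₀ hfix)⟩
  have ht : Tendsto (fun k => ((Φ - Φ * gainOf H R Pm * H) ^ k)ᵀ) atTop (𝓝 0) :=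
    tendsto_matrix_iff.2 fun i j => hS.tendsto_pow_apply j i
  simpa using (tendsto_const_nhds (x := Pm)).add
    (tendsto_matrix_mul (tendsto_matrix_mul hA (tendsto_const_nhds (x := P₀ - Pm))) ht)

end Stabilizable

/-! ### Convergence of the covariances from convergence of the gains -/

section GainConvergence

variable {n m : Type*} [Fintype n] [Fintype m] [DecidableEq n] [DecidableEq m]
  {Φ : Matrix n n ℝ} {H : Matrix m n ℝ} {Q : Matrix n n ℝ} {R : Matrix m m ℝ}

/-- Along a backward orbit of the Riccati recursion with constant gain `K`, the powers of the closed
loop matrix are controlled by the covariances. -/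
lemma pow_mul_mul_transpose_le {K : Matrix n m ℝ} (hQ : Q.PosSemidef) (hR : R.PosDef)
    {L : ℕ → Matrix n n ℝ} (hL : ∀ i, (L i).PosSemidef)
    (hstep : ∀ i, L i = riccatiStep Φ H Q R (L (i + 1))) (hK : ∀ i, gainOf H R (L i) = K)
    (i : ℕ) : (Φ - Φ * K * H) ^ i * L i * ((Φ - Φ * K * H) ^ i)ᵀ ≤ L 0 := by
  induction i with
  | zero => simp
  | succ i ih =>
    refine le_trans ?_ ih
    have h : (Φ - Φ * K * H) * L (i + 1) * (Φ - Φ * K * H)ᵀ ≤ L i := by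
      rw [hstep i, riccatiStep_eq_predictor hR (hL _), hK, Matrix.le_iff, add_sub_cancel_left]
      exact (posSemidef_mul_mul_transpose hR.posSemidef _).add hQ
    refine le_trans (le_of_eq ?_) (mul_mul_transpose_le h _)
    simp only [pow_succ, transpose_mul, Matrix.mul_assoc]

/-- Two bounded backward orbits of the Riccati recursion with the same constant gain have the same
end point. -/
lemma eq_of_backward_orbits {K : Matrix n m ℝ} (hQ : Q.PosSemidef) (hR : R.PosDef)
    (hdet : IsDetectable Φ H) {c : ℝ} {L L' : ℕ → Matrix n n ℝ}
    (hL : ∀ i, (L i).PosSemidef) (hL' : ∀ i, (L' i).PosSemidef)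
    (hstep : ∀ i, L i = riccatiStep Φ H Q R (L (i + 1)))
    (hstep' : ∀ i, L' i = riccatiStep Φ H Q R (L' (i + 1)))
    (hK : ∀ i, gainOf H R (L i) = K) (hK' : ∀ i, gainOf H R (L' i) = K)
    (hc : ∀ i, (L i).trace ≤ c) (hc' : ∀ i, (L' i).trace ≤ c) : L 0 = L' 0 := by
  obtain ⟨M, hM⟩ := hdet
  obtain ⟨A, hA⟩ : ∃ A, A = Φ - Φ * K * H := ⟨_, rfl⟩
  have hA' : A = Φ * (1 - K * H) := by
    rw [hA, Matrix.mul_sub, Matrix.mul_one, Matrix.mul_assoc]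
  -- The gain equation rearranges to `(1 - K H) P Hᵀ = K R`, so `A P Hᵀ` is the same for all `P`
  -- with gain `K`.
  have hgain : ∀ P : Matrix n n ℝ, P.PosSemidef → gainOf H R P = K → A * P * Hᵀ = Φ * K * R := by
    intro P hP hPK
    have h := gainOf_mul_innovation (H := H) hR hP
    rw [hPK] at h
    have h' : (1 - K * H) * (P * Hᵀ) = K * R := by
      rw [Matrix.sub_mul, Matrix.one_mul, ← sub_eq_zero]
      nth_rewrite 1 [← h]
      simp only [Matrix.mul_add, Matrix.mul_assoc]
      abel
    rw [hA', Matrix.mul_assoc, Matrix.mul_assoc, h', Matrix.mul_assoc]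
  -- Hence `Φ` in the right factor of `A P Φᵀ` may be replaced by `Φ - M H` at the cost of a
  -- constant, which cancels in the difference.
  have hdiff : ∀ i, L i - L' i = A * (L (i + 1) - L' (i + 1)) * (Φ - M * H)ᵀ := by
    intro i
    have e : ∀ P : Matrix n n ℝ, P.PosSemidef → gainOf H R P = K →
        riccatiStep Φ H Q R P = A * P * (Φ - M * H)ᵀ + Φ * K * R * Mᵀ + Q := by
      intro P hP hPK
      rw [← hgain P hP hPK, riccatiStep, posteriorOf, hPK, hA', transpose_sub, transpose_mul]
      simp only [Matrix.mul_sub, Matrix.sub_mul, Matrix.mul_assoc, Matrix.one_mul, Matrix.mul_one]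
      abel
    rw [hstep i, hstep' i, e _ (hL _) (hK _), e _ (hL' _) (hK' _), Matrix.mul_sub, Matrix.sub_mul]
    abel
  have hpow : ∀ i, L 0 - L' 0 = (A ^ i * L i - A ^ i * L' i) * ((Φ - M * H) ^ i)ᵀ := by
    intro i
    induction i with
    | zero => simp
    | succ i ih =>
      rw [ih, ← Matrix.mul_sub, hdiff i, ← Matrix.mul_sub]
      simp only [pow_succ, transpose_mul, Matrix.mul_assoc]
  -- Cauchy-Schwarz together with `A ^ i L i (A ^ i)ᵀ ≤ L 0` bounds `A ^ i L i` without stability of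
  -- `A`.
  have hb : ∀ i a b, |(A ^ i * L i) a b| ≤ c + c := fun i a b =>
    (abs_mul_posSemidef_apply_le (hL i) _ a b).trans (add_le_add
      ((trace_le_trace (hA ▸ pow_mul_mul_transpose_le hQ hR hL hstep hK i)).trans (hc 0)) (hc i))
  have hb' : ∀ i a b, |(A ^ i * L' i) a b| ≤ c + c := fun i a b =>
    (abs_mul_posSemidef_apply_le (hL' i) _ a b).trans (add_le_add
      ((trace_le_trace (hA ▸ pow_mul_mul_transpose_le hQ hR hL' hstep' hK' i)).trans (hc' 0))
      (hc' i))
  have hzero : Tendsto (fun i => (A ^ i * L i - A ^ i * L' i) * ((Φ - M * H) ^ i)ᵀ) atTop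
      (𝓝 0) := by
    refine tendsto_matrix_iff.2 fun a b => ?_
    simp only [mul_apply, transpose_apply, Matrix.zero_apply]
    rw [← Finset.sum_const_zero (s := (Finset.univ : Finset n))]
    refine tendsto_finsetSum _ fun j _ => ?_
    refine squeeze_zero_norm (a := fun i => (c + c + (c + c)) * |((Φ - M * H) ^ i) b j|) (fun i => ?_)
      (by simpa using (hM.tendsto_pow_apply b j).abs.const_mul (c + c + (c + c)))
    rw [norm_mul]
    refine mul_le_mul_of_nonneg_right ?_ (norm_nonneg _)
    exact (norm_sub_le _ _).trans (add_le_add (hb i a j) (hb' i a j))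
  simp only [← hpow] at hzero
  exact sub_eq_zero.1 (tendsto_nhds_unique tendsto_const_nhds hzero)

/-- Along an ultrafilter at infinity, the shifted covariances converge to a backward orbit. -/
lemma exists_backward_orbit {P₀ : Matrix n n ℝ} {K : Matrix n m ℝ} (hQ : Q.PosSemidef)
    (hR : R.PosDef) (h₀ : P₀.PosSemidef) {c : ℝ} (hc : ∀ k, (priorCov Φ H Q R P₀ k).trace ≤ c)
    (hK : Tendsto (kalmanGain Φ H Q R P₀) atTop (𝓝 K)) (U : Ultrafilter ℕ)
    (hU : (U : Filter ℕ) ≤ atTop) :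
    ∃ L : ℕ → Matrix n n ℝ, Tendsto (priorCov Φ H Q R P₀) U (𝓝 (L 0)) ∧
      (∀ i, (L i).PosSemidef) ∧ (∀ i, L i = riccatiStep Φ H Q R (L (i + 1))) ∧
      (∀ i, gainOf H R (L i) = K) ∧ ∀ i, (L i).trace ≤ c := by
  have hcomp : IsCompact (Set.univ.pi fun _ : n => Set.univ.pi fun _ : n =>
      Set.Icc (-(2 * c)) (2 * c)) :=
    isCompact_univ_pi fun _ => isCompact_univ_pi fun _ => isCompact_Icc
  have hlim : ∀ i, ∃ X : Matrix n n ℝ,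
      Tendsto (fun k => priorCov Φ H Q R P₀ (k - i)) U (𝓝 X) := by
    intro i
    obtain ⟨X, -, hX⟩ := hcomp.ultrafilter_le_nhds (U.map fun k => priorCov Φ H Q R P₀ (k - i)) (by
      refine Filter.le_principal_iff.2 (Filter.mem_map.2 (Filter.univ_mem' fun k => ?_))
      refine Set.mem_univ_pi.2 fun a => Set.mem_univ_pi.2 fun b => ?_
      refine abs_le.1 ((abs_posSemidef_apply_le (posSemidef_priorCov hQ hR h₀ _) a b).trans ?_)
      exact mul_le_mul_of_nonneg_left (hc _) zero_le_two)
    exact ⟨X, hX⟩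
  choose L hL using hlim
  have hpsd : ∀ i, (L i).PosSemidef := fun i => posSemidef_of_tendsto
    (Eventually.of_forall fun k => posSemidef_priorCov hQ hR h₀ (k - i)) (hL i)
  have hsub : ∀ i, Tendsto (fun k => k - i) (U : Filter ℕ) atTop := fun i =>
    (tendsto_sub_atTop_nat i).mono_left hU
  refine ⟨L, hL 0, hpsd, fun i => ?_, fun i => ?_, fun i => ?_⟩
  · refine tendsto_nhds_unique (hL i) ?_
    refine ((continuousAt_riccatiStep hR (hpsd (i + 1))).tendsto.comp (hL (i + 1))).congr' ?_
    -- The subtraction `k - i` is truncated; for `k ≥ i + 1` the step from `k - (i + 1)` really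
    -- leads to `k - i`.
    filter_upwards [hU (eventually_ge_atTop (i + 1))] with k hk
    rw [Function.comp_apply, ← priorCov_succ]
    congr 1
    omega
  -- The gains at times `k - i` have the same limit for every `i`; this makes the gain constant
  -- along the limit orbit.
  · exact tendsto_nhds_unique ((continuousAt_gainOf hR (hpsd i)).tendsto.comp (hL i))
      (hK.comp (hsub i))
  · exact le_of_tendsto (((continuous_id.matrix_trace).tendsto (L i)).comp (hL i))
      (Eventually.of_forall fun k => hc _)

/-- Under detectability, convergence of the Kalman gains entails convergence of the covariances. -/
lemma exists_tendsto_priorCov_of_tendsto_kalmanGain {P₀ : Matrix n n ℝ} {K : Matrix n m ℝ}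
    (hQ : Q.PosSemidef) (hR : R.PosDef) (hdet : IsDetectable Φ H) (h₀ : P₀.PosSemidef)
    (hK : Tendsto (kalmanGain Φ H Q R P₀) atTop (𝓝 K)) :
    ∃ Pm, Tendsto (priorCov Φ H Q R P₀) atTop (𝓝 Pm) := by
  obtain ⟨c, hc⟩ := exists_trace_priorCov_le hQ hR hdet h₀
  obtain ⟨L, -, h1, h2, h3, h4⟩ :=
    exists_backward_orbit hQ hR h₀ hc hK (Ultrafilter.of atTop) (Ultrafilter.of_le _)
  -- One ultrafilter supplies the candidate limit; the end point along any other equals it.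
  refine ⟨L 0, tendsto_iff_ultrafilter _ _ _ |>.2 fun U hU => ?_⟩
  obtain ⟨L', h0', h1', h2', h3', h4'⟩ := exists_backward_orbit hQ hR h₀ hc hK U hU
  rwa [eq_of_backward_orbits hQ hR hdet h1 h1' h2 h2' h3 h3' h4 h4']

end GainConvergence

end KalmanSmoother

theorem lemma1 {n m : Type*} [Fintype n] [DecidableEq n] [Fintype m] [DecidableEq m]
    (Φ : Matrix n n ℝ) (H : Matrix m n ℝ) (Q : Matrix n n ℝ) (R : Matrix m m ℝ)
    (hQ : Q.PosSemidef) (hR : R.PosDef) (hdet : KalmanSmoother.IsDetectable Φ H) :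
    -- stabilizable case: the filter converges, to limits that do not depend on the initial
    -- covariance, and so do the smoother gains
    (KalmanSmoother.IsStabilizable Φ (CFC.sqrt Q) →
      ∃ (Pm Pp : Matrix n n ℝ) (K : Matrix n m ℝ),
        KalmanSmoother.IsSteadyState Φ H Q R Pm Pp K ∧
        ∀ P₀ : Matrix n n ℝ, P₀.PosSemidef →
          Tendsto (KalmanSmoother.kalmanGain Φ H Q R P₀) atTop (𝓝 K) ∧
          Tendsto (KalmanSmoother.priorCov Φ H Q R P₀) atTop (𝓝 Pm) ∧
          Tendsto (KalmanSmoother.posteriorCov Φ H Q R P₀) atTop (𝓝 Pp) ∧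
          (IsUnit Pp →
            (∀ᶠ k in atTop, IsUnit (KalmanSmoother.priorCov Φ H Q R P₀ (k + 1))) ∧
            Tendsto (KalmanSmoother.smootherGain Φ H Q R P₀) atTop
              (𝓝 (Pp * Φᵀ * Pp⁻¹ * (1 - K * H))))) ∧
    -- general case: convergence of the Kalman gains alone is enough
    (∀ P₀ : Matrix n n ℝ, P₀.PosSemidef → ∀ K : Matrix n m ℝ,
      Tendsto (KalmanSmoother.kalmanGain Φ H Q R P₀) atTop (𝓝 K) →
      ∃ Pm Pp : Matrix n n ℝ,
        KalmanSmoother.IsSteadyState Φ H Q R Pm Pp K ∧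
        Tendsto (KalmanSmoother.priorCov Φ H Q R P₀) atTop (𝓝 Pm) ∧
        Tendsto (KalmanSmoother.posteriorCov Φ H Q R P₀) atTop (𝓝 Pp) ∧
        (IsUnit Pp →
          (∀ᶠ k in atTop, IsUnit (KalmanSmoother.priorCov Φ H Q R P₀ (k + 1))) ∧
          Tendsto (KalmanSmoother.smootherGain Φ H Q R P₀) atTop
            (𝓝 (Pp * Φᵀ * Pp⁻¹ * (1 - K * H))))) := by
  constructor
  · intro hstab
    obtain ⟨Pm, hPm⟩ := KalmanSmoother.exists_tendsto_priorCov hQ hR hdet hstab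
    refine ⟨Pm, KalmanSmoother.posteriorOf H R Pm, KalmanSmoother.gainOf H R Pm,
      KalmanSmoother.isSteadyState_of_riccatiStep_eq_self
        (KalmanSmoother.riccatiStep_eq_self_of_tendsto hQ hR .zero (hPm 0 .zero)),
      fun P₀ h₀ => ?_⟩
    obtain ⟨h1, h2, h3⟩ := KalmanSmoother.tendsto_of_tendsto_priorCov hQ hR h₀ (hPm P₀ h₀)
    exact ⟨h1, hPm P₀ h₀, h2, h3⟩
  · intro P₀ h₀ K hK
    obtain ⟨Pm, hPm⟩ :=
      KalmanSmoother.exists_tendsto_priorCov_of_tendsto_kalmanGain hQ hR hdet h₀ hK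
    obtain ⟨h1, h2, h3⟩ := KalmanSmoother.tendsto_of_tendsto_priorCov hQ hR h₀ hPm
    -- The given limit of the gains is the gain of the limit covariance.
    obtain rfl := tendsto_nhds_unique hK h1
    exact ⟨Pm, KalmanSmoother.posteriorOf H R Pm,
      KalmanSmoother.isSteadyState_of_riccatiStep_eq_self
        (KalmanSmoother.riccatiStep_eq_self_of_tendsto hQ hR h₀ hPm), hPm, h2, h3⟩
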